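/- Write $\mathcal M_d$ for the complex $d\times d$ matrices. A quantum state is a positive semi-definite matrix of unit trace, and $A\le B$ means that $B-A$ is positive semi-definite. A quantum channel is a completely positive trace-preserving linear map $\Phi:\mathcal M_d\to\mathcal M_{d'}$; its adjoint $\Phi^*$ is the linear map with $\operatorname{Tr}[\Phi(X)Y]=\operatorname{Tr}[X\Phi^*(Y)]$ for all $X,Y$. Channels $\Phi:\mathcal M_d\to\mathcal M_{d_{\rm out}}$ and $\Phi_c:\mathcal M_d\to\mathcal M_{d_{\rm env}}$ are complementary if there is an isometry $V:\mathbb C^d\to\mathbb C^{d_{\rm out}}\otimes\mathbb C^{d_{\rm env}}$ such that $\Phi(X)=\operatorname{Tr}_{\rm env}(VXV^\dagger)$ and $\Phi_c(X)=\operatorname{Tr}_{\rm out}(VXV^\dagger)$ for all $X\in\mathcal M_d$. With $S(\rho)=-\operatorname{Tr}(\rho\log\rho)$, the coherent information of a channel $\Phi$ is $$\mathcal Q^{(1)}(\Phi)=\max_{\rho}\,\bigl(S(\Phi(\rho))-S(\Phi_c(\rho))\bigr),$$ the maximum being over all states $\rho$ of the input space, where $\Phi_c$ is any channel complementary to $\Phi$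 (the value does not depend on the choice), and the quantum capacity of $\Phi$ is $$\mathcal Q(\Phi)=\lim_{n\to\infty}\frac{\mathcal Q^{(1)}(\Phi^{\otimes n})}{n}.$$ **Theorem.** Let $\Phi:\mathcal M_d\to\mathcal M_{d_{\rm out}}$ and $\Phi_c:\mathcal M_d\to\mathcal M_{d_{\rm env}}$ be complementary channels with $\mathcal Q(\Phi)=0$. Then for every $n\in\mathbb N$ and every unit vector $|\psi\rangle\in(\mathbb C^d)^{\otimes n}$, $$(\Phi_c^{\otimes n})^*(R^c_\psi)\;\le\;(\Phi^{\otimes n})^*(R_\psi),$$ where $R_\psi$ and $R^c_\psi$ denote the orthogonal projections onto the ranges of $\Phi^{\otimes n}(|\psi\rangle\langle\psi|)$ and $\Phi_c^{\otimes n}(|\psi\rangle\langle\psi|)$, respectively. -/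

import Mathlib

set_option linter.unusedSectionVars false

open scoped MatrixOrder ComplexOrder

noncomputable section

namespace QChan

variable {a b e : Type*} [Fintype a] [Fintype b] [Fintype e]
  [DecidableEq a] [DecidableEq b] [DecidableEq e]

/-! Complex matrices indexed by a finite type `a` model the operators on the Hilbert space `ℂᵃ`.
Linear maps between such matrix algebras are `Matrix a a ℂ →ₗ[ℂ] Matrix b b ℂ`. -/

/-- Quantum states: positive semi-definite matrices of unit trace. -/
def IsState (ρ : Matrix a a ℂ) : Prop := ρ.PosSemidef ∧ ρ.trace = 1

/-- Unit vectors, for the Hermitian inner product. -/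
def IsUnitVector (ψ : a → ℂ) : Prop := star ψ ⬝ᵥ ψ = 1

/-- The rank-one operator `|ψ⟩⟨ψ|`; it is a pure state when `ψ` is a unit vector. -/
def ketbra (ψ : a → ℂ) : Matrix a a ℂ := Matrix.vecMulVec ψ (star ψ)

/-- The map `Φ ⊗ id_k`: apply `Φ` to each of the `k × k` blocks of `M`. -/
def ampliation (Φ : Matrix a a ℂ →ₗ[ℂ] Matrix b b ℂ) (k : ℕ)
    (M : Matrix (a × Fin k) (a × Fin k) ℂ) : Matrix (b × Fin k) (b × Fin k) ℂ :=
  Matrix.of fun x y =>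
    Φ (Matrix.of fun i j => M (i, x.2) (j, y.2)) x.1 y.1

/-- Completely positive and trace preserving linear maps. -/
structure IsChannel (Φ : Matrix a a ℂ →ₗ[ℂ] Matrix b b ℂ) : Prop where
  completely_positive : ∀ (k : ℕ) (M : Matrix (a × Fin k) (a × Fin k) ℂ),
    M.PosSemidef → (ampliation Φ k M).PosSemidef
  trace_preserving : ∀ X : Matrix a a ℂ, (Φ X).trace = X.trace

/-- Partial trace over the second tensor factor. -/
def traceSnd (M : Matrix (b × e) (b × e) ℂ) : Matrix b b ℂ :=
  Matrix.of fun i j => ∑ k, M (i, k) (j, k)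

/-- Partial trace over the first tensor factor. -/
def traceFst (M : Matrix (b × e) (b × e) ℂ) : Matrix e e ℂ :=
  Matrix.of fun i j => ∑ k, M (k, i) (k, j)

/-- `Φ` and `Φc` are complementary: for some isometry `V : ℂᵃ → ℂᵇ ⊗ ℂᵉ`,
`Φ X` and `Φc X` are the two partial traces of `V X V†`. -/
def IsComplementary (Φ : Matrix a a ℂ →ₗ[ℂ] Matrix b b ℂ)
    (Φc : Matrix a a ℂ →ₗ[ℂ] Matrix e e ℂ) : Prop :=
  ∃ V : Matrix (b × e) a ℂ, V.conjTranspose * V = 1 ∧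
    ∀ X : Matrix a a ℂ, Φ X = traceSnd (V * X * V.conjTranspose) ∧
      Φc X = traceFst (V * X * V.conjTranspose)

/-- The von Neumann entropy `-Tr (ρ log ρ)`, with natural logarithm and `0 log 0 = 0`; here
`cfc Real.log ρ` applies `Real.log` to the eigenvalues of the Hermitian matrix `ρ`. -/
def entropy (ρ : Matrix a a ℂ) : ℝ := -(ρ * cfc Real.log ρ).trace.re

/-- `x` is the coherent information `S(Φ ρ) - S(Φc ρ)` of `ρ` with respect to `Φ`, computed with
some channel `Φc` complementary to `Φ` (all choices of `Φc` are isometrically related and give the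
same number). The environment is any finite-dimensional space. -/
def IsCoherentInformation (Φ : Matrix a a ℂ →ₗ[ℂ] Matrix b b ℂ) (ρ : Matrix a a ℂ) (x : ℝ) :
    Prop :=
  ∃ (E : Type) (_ : Fintype E) (_ : DecidableEq E) (Φc : Matrix a a ℂ →ₗ[ℂ] Matrix E E ℂ),
    IsComplementary Φ Φc ∧ x = entropy (Φ ρ) - entropy (Φc ρ)

/-- The coherent information of `Φ`: the maximum over all states `ρ` of the coherent information
of `ρ` with respect to `Φ`. -/
def maxCoherentInformation (Φ : Matrix a a ℂ →ₗ[ℂ] Matrix b b ℂ) : ℝ :=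
  sSup {x : ℝ | ∃ ρ : Matrix a a ℂ, IsState ρ ∧ IsCoherentInformation Φ ρ x}

/-- The elementary tensor `A 0 ⊗ ⋯ ⊗ A (n - 1)`, as a matrix indexed by `Fin n → a`. -/
def tensorMatrix {n : ℕ} (A : Fin n → Matrix a a ℂ) : Matrix (Fin n → a) (Fin n → a) ℂ :=
  Matrix.of fun f g => ∏ i, A i (f i) (g i)

/-- The `n`-fold tensor power `Φ^{⊗n}`: the matrix unit `E_{h,k} = ⨂ E_{h i, k i}` is sent to
`⨂ Φ(E_{h i, k i})`, extended linearly. -/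
def tensorPower (Φ : Matrix a a ℂ →ₗ[ℂ] Matrix b b ℂ) (n : ℕ) :
    Matrix (Fin n → a) (Fin n → a) ℂ →ₗ[ℂ] Matrix (Fin n → b) (Fin n → b) ℂ where
  toFun X := ∑ h : Fin n → a, ∑ k : Fin n → a,
    X h k • tensorMatrix fun i => Φ (Matrix.single (h i) (k i) 1)
  map_add' X Y := by simp [add_smul, Finset.sum_add_distrib]
  map_smul' c X := by simp [mul_smul, Finset.smul_sum]

/-- `Φ^{⊗n} (A 0 ⊗ ⋯ ⊗ A (n - 1)) = Φ (A 0) ⊗ ⋯ ⊗ Φ (A (n - 1))`. -/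
theorem tensorPower_tensorMatrix (Φ : Matrix a a ℂ →ₗ[ℂ] Matrix b b ℂ) {n : ℕ}
    (A : Fin n → Matrix a a ℂ) :
    tensorPower Φ n (tensorMatrix A) = tensorMatrix fun i => Φ (A i) := by
  have key : ∀ (B : Matrix a a ℂ) (p q : b),
      Φ B p q = ∑ x : a × a, B x.1 x.2 * Φ (Matrix.single x.1 x.2 1) p q := by
    intro B p q
    conv_lhs => rw [Matrix.matrix_eq_sum_single B]
    simp only [map_sum, Matrix.sum_apply]
    rw [Fintype.sum_prod_type]
    refine Finset.sum_congr rfl fun i _ => Finset.sum_congr rfl fun j _ => ?_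
    have : Matrix.single i j (B i j) = B i j • Matrix.single i j (1 : ℂ) := by
      simp [Matrix.smul_single]
    rw [this, map_smul, Matrix.smul_apply, smul_eq_mul]
  ext f g
  simp only [tensorPower, tensorMatrix, LinearMap.coe_mk, AddHom.coe_mk, Matrix.sum_apply,
    Matrix.smul_apply, Matrix.of_apply, smul_eq_mul]
  simp_rw [key (A _)]
  rw [Finset.prod_univ_sum, Fintype.piFinset_univ, ← Fintype.sum_prod_type',
    ← (Equiv.arrowProdEquivProdArrow (Fin n) (fun _ => a) (fun _ => a)).sum_comp]
  refine Finset.sum_congr rfl fun x _ => ?_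
  rw [Finset.prod_mul_distrib]
  rfl

/-- The quantum capacity `Q(Φ) = lim_n Q¹(Φ^{⊗n}) / n`. -/
def quantumCapacity (Φ : Matrix a a ℂ →ₗ[ℂ] Matrix b b ℂ) : ℝ :=
  Filter.limUnder Filter.atTop fun n : ℕ => maxCoherentInformation (tensorPower Φ n) / (n : ℝ)

/-- The adjoint `Φ*`, determined by `Tr (Φ X * Y) = Tr (X * Φ* Y)`, see `trace_adjoint`. -/
def adjoint (Φ : Matrix a a ℂ →ₗ[ℂ] Matrix b b ℂ) : Matrix b b ℂ →ₗ[ℂ] Matrix a a ℂ where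
  toFun Y := Matrix.of fun i j => (Φ (Matrix.single j i 1) * Y).trace
  map_add' X Y := by ext; simp [mul_add]
  map_smul' c X := by ext; simp

theorem trace_adjoint (Φ : Matrix a a ℂ →ₗ[ℂ] Matrix b b ℂ) (X : Matrix a a ℂ)
    (Y : Matrix b b ℂ) : (Φ X * Y).trace = (X * adjoint Φ Y).trace := by
  have h : Φ X = ∑ i, ∑ j, X i j • Φ (Matrix.single i j 1) := by
    conv_lhs => rw [Matrix.matrix_eq_sum_single X]
    simp only [map_sum]
    refine Finset.sum_congr rfl fun i _ => Finset.sum_congr rfl fun j _ => ?_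
    rw [← map_smul, Matrix.smul_single, smul_eq_mul, mul_one]
  rw [h]
  simp only [Finset.sum_mul, Matrix.trace_sum, Matrix.smul_mul, Matrix.trace_smul, smul_eq_mul]
  simp only [Matrix.trace, Matrix.diag, Matrix.mul_apply (M := X), adjoint, LinearMap.coe_mk,
    AddHom.coe_mk, Matrix.of_apply]

/-- The orthogonal projection onto the range of `A`, as a matrix. -/
def rangeProjection (A : Matrix a a ℂ) : Matrix a a ℂ :=
  (Matrix.toEuclideanCLM (n := a) (𝕜 := ℂ)).symm
    (LinearMap.range (Matrix.toEuclideanLin A)).starProjection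

end QChan

end

/-! The mechanism is a logarithmic singularity of the entropy. For states `A`, `B` and ε → 0⁺,
S((1-ε)A + εB) = S(A) + ε log(1/ε) (1 - Tr(B P_A)) + O(ε), where P_A projects onto the range of A:
only the weight of B on the kernel of A is felt at order ε log(1/ε). The upper half is
`entropy_mix_le`, the lower half `le_entropy_mix`.

By superadditivity and Fekete's lemma, capacity zero forces S(Φ^{⊗n}(ρ)) ≤ S(Φc^{⊗n}(ρ)) for all n
and ρ (`IsComplementary.entropy_le_of_quantumCapacity`). At ρ = |ψ⟩⟨ψ| equality holds, the outputs
being the two marginals of one pure state (`IsComplementary.entropy_ketbra`). Perturbing ψ towards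
any other pure state φ must preserve the inequality, so the coefficients of ε log(1/ε) are ordered
in the same way (`trace_mul_rangeProjection_le`). Hence Tr(Φc^{⊗n}(φ) R^c_ψ) ≤ Tr(Φ^{⊗n}(φ) R_ψ) for
every φ, and moving the maps to the other side of the trace gives the operator inequality. -/

noncomputable section

namespace QChan

open Matrix Real
open scoped Kronecker

variable {a b e : Type*} [Fintype a] [Fintype b] [Fintype e]
  [DecidableEq a] [DecidableEq b] [DecidableEq e]

/-! ### Spectral decompositions and basic entropy inequalities. -/

/-- The functional calculus of a Hermitian matrix acts on the eigenvalues in an eigenbasis. -/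
theorem eq_conj_diagonal {A : Matrix a a ℂ} (hA : A.IsHermitian) (f : ℝ → ℝ) :
    cfc f A = (hA.eigenvectorUnitary : Matrix a a ℂ) *
      diagonal (fun i => ((f (hA.eigenvalues i) : ℝ) : ℂ)) *
      (hA.eigenvectorUnitary : Matrix a a ℂ)ᴴ := by
  rw [hA.cfc_eq]
  rfl

theorem eigenvectorUnitary_conjTranspose_mul {A : Matrix a a ℂ} (hA : A.IsHermitian) :
    (hA.eigenvectorUnitary : Matrix a a ℂ)ᴴ * (hA.eigenvectorUnitary : Matrix a a ℂ) = 1 :=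
  Unitary.coe_star_mul_self hA.eigenvectorUnitary

theorem eigenvectorUnitary_mul_conjTranspose {A : Matrix a a ℂ} (hA : A.IsHermitian) :
    (hA.eigenvectorUnitary : Matrix a a ℂ) * (hA.eigenvectorUnitary : Matrix a a ℂ)ᴴ = 1 :=
  Unitary.coe_mul_star_self hA.eigenvectorUnitary

theorem eq_conj_diagonal_eigenvalues {A : Matrix a a ℂ} (hA : A.IsHermitian) :
    A = (hA.eigenvectorUnitary : Matrix a a ℂ) *
      diagonal (fun i => ((hA.eigenvalues i : ℝ) : ℂ)) *
      (hA.eigenvectorUnitary : Matrix a a ℂ)ᴴ := by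
  conv_lhs => rw [hA.spectral_theorem]
  rfl

theorem conj_eq_of_eq_conj {A U D : Matrix a a ℂ} (hU : Uᴴ * U = 1) (h : A = U * D * Uᴴ) :
    Uᴴ * A * U = D := by
  rw [h, Matrix.mul_assoc, Matrix.mul_assoc, hU, Matrix.mul_one, ← Matrix.mul_assoc, hU,
    Matrix.one_mul]

theorem trace_mul_conj_diagonal (M U : Matrix a a ℂ) (p : a → ℂ) :
    (M * (U * diagonal p * Uᴴ)).trace = ∑ i, (Uᴴ * M * U) i i * p i := by
  rw [← Matrix.mul_assoc, Matrix.trace_mul_comm, ← Matrix.mul_assoc, ← Matrix.mul_assoc,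
    Matrix.trace]
  simp [Matrix.mul_diagonal]

theorem trace_eq_sum_conj {U : Matrix a a ℂ} (hU : U * Uᴴ = 1) (M : Matrix a a ℂ) :
    M.trace = ∑ i, (Uᴴ * M * U) i i := by
  change _ = (Uᴴ * M * U).trace
  rw [Matrix.mul_assoc, Matrix.trace_mul_comm, Matrix.mul_assoc, hU, Matrix.mul_one]

theorem entropy_eq_sum_eigenvalues {ρ : Matrix a a ℂ} (h : ρ.IsHermitian) :
    entropy ρ = ∑ i, negMulLog (h.eigenvalues i) := by
  have hd := conj_eq_of_eq_conj (eigenvectorUnitary_conjTranspose_mul h)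
    (eq_conj_diagonal_eigenvalues h)
  rw [entropy, eq_conj_diagonal h, trace_mul_conj_diagonal, hd]
  simp only [diagonal_apply_eq, ← Complex.ofReal_mul, ← Complex.ofReal_sum, Complex.ofReal_re,
    negMulLog_eq_neg, Finset.sum_neg_distrib]

/-- Free of any choice or ordering of eigenvectors, this form reduces each invariance of the entropy
to an identity of characteristic polynomials. -/
theorem entropy_eq_sum_roots {ρ : Matrix a a ℂ} (h : ρ.IsHermitian) :
    entropy ρ = (ρ.charpoly.roots.map fun z => negMulLog z.re).sum := by
  rw [entropy_eq_sum_eigenvalues h, h.roots_charpoly_eq_eigenvalues]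
  simp

theorem entropy_conj_diagonal {U : Matrix a a ℂ} (hU : Uᴴ * U = 1) (p : a → ℝ) :
    entropy (U * diagonal (fun i => (p i : ℂ)) * Uᴴ) = ∑ i, negMulLog (p i) := by
  have hd : (diagonal (fun i => (p i : ℂ))).IsHermitian := by
    rw [Matrix.isHermitian_diagonal_iff]; intro i; simp [IsSelfAdjoint]
  rw [entropy_eq_sum_roots (Matrix.isHermitian_mul_mul_conjTranspose _ hd),
    Matrix.charpoly_mul_comm, ← Matrix.mul_assoc, hU, Matrix.one_mul, charpoly_diagonal,
    Polynomial.roots_prod _ _ (Finset.prod_ne_zero_iff.mpr fun i _ => Polynomial.X_sub_C_ne_zero _)]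
  simp

/-- The right side is the tangent at `s` to the concave function -x log x. -/
theorem negMulLog_le_of_pos {x s : ℝ} (hx : 0 ≤ x) (hs : 0 < s) :
    negMulLog x ≤ -(x * Real.log s) + s - x := by
  rcases hx.eq_or_lt with rfl | hx
  · simpa using hs.le
  · have := Real.log_le_sub_one_of_pos (div_pos hs hx)
    rw [Real.log_div hs.ne' hx.ne'] at this
    have h2 := mul_le_mul_of_nonneg_left this hx.le
    have h3 : x * (s / x - 1) = s - x := by field_simp
    rw [negMulLog]
    linarith

theorem diag_conj_nonneg {ρ : Matrix a a ℂ} (hρ : ρ.PosSemidef) (U : Matrix a a ℂ) (j : a) :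
    0 ≤ ((Uᴴ * ρ * U) j j).re :=
  (Complex.nonneg_iff.mp (hρ.conjTranspose_mul_mul_same U).diag_nonneg).1

theorem conj_diagonal_apply_self (W : Matrix a a ℂ) (p : a → ℝ) (j : a) :
    ((W * diagonal (fun i => (p i : ℂ)) * Wᴴ) j j).re = ∑ i, ‖W j i‖ ^ 2 * p i := by
  rw [Matrix.mul_apply]
  simp only [Matrix.mul_diagonal, Matrix.conjTranspose_apply, Complex.re_sum]
  refine Finset.sum_congr rfl fun i _ => ?_
  rw [mul_right_comm, Complex.star_def, Complex.mul_conj, Complex.normSq_eq_norm_sq,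
    ← Complex.ofReal_mul, Complex.ofReal_re]

theorem sum_norm_sq_row {W : Matrix a a ℂ} (hW : W * Wᴴ = 1) (j : a) :
    ∑ i, ‖W j i‖ ^ 2 = 1 := by
  have h := conj_diagonal_apply_self W (fun _ => 1) j
  simpa [hW] using h.symm

/-- The entropy increases when a matrix is replaced by its diagonal in an orthonormal basis. -/
theorem entropy_le_sum_diag {ρ U : Matrix a a ℂ} (hρ : ρ.PosSemidef) (hU : Uᴴ * U = 1) :
    entropy ρ ≤ ∑ j, negMulLog ((Uᴴ * ρ * U) j j).re := by
  set V : Matrix a a ℂ := (hρ.1.eigenvectorUnitary : Matrix a a ℂ) with hV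
  set p := hρ.1.eigenvalues with hp
  have hU' : U * Uᴴ = 1 := mul_eq_one_comm.mp hU
  have hV1 : Vᴴ * V = 1 := eigenvectorUnitary_conjTranspose_mul hρ.1
  have hV2 : V * Vᴴ = 1 := eigenvectorUnitary_mul_conjTranspose hρ.1
  -- The squared moduli of this change of basis are doubly stochastic: row sums give the Jensen
  -- weights, column sums recover the entropy after the sums are exchanged.
  set W := Uᴴ * V with hW
  have hW1 : W * Wᴴ = 1 := by
    rw [hW, conjTranspose_mul, conjTranspose_conjTranspose, Matrix.mul_assoc,
      ← Matrix.mul_assoc V, hV2, Matrix.one_mul, hU]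
  have hW2 : Wᴴ * W = 1 := mul_eq_one_comm.mp hW1
  have hconj : Uᴴ * ρ * U = W * diagonal (fun i => (p i : ℂ)) * Wᴴ := by
    conv_lhs => rw [eq_conj_diagonal_eigenvalues hρ.1]
    simp only [hW, conjTranspose_mul, conjTranspose_conjTranspose, Matrix.mul_assoc]
    rfl
  have hcol : ∀ i, ∑ j, ‖W j i‖ ^ 2 = 1 := by
    intro i
    have := sum_norm_sq_row (W := Wᴴ) (by rwa [conjTranspose_conjTranspose]) i
    simpa [conjTranspose_apply] using this
  rw [entropy_eq_sum_eigenvalues hρ.1, hconj]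
  calc ∑ i, negMulLog (p i) = ∑ i, ∑ j, ‖W j i‖ ^ 2 * negMulLog (p i) := by
        simp_rw [← Finset.sum_mul, hcol, one_mul]
    _ = ∑ j, ∑ i, ‖W j i‖ ^ 2 * negMulLog (p i) := Finset.sum_comm
    _ ≤ _ := by
        refine Finset.sum_le_sum fun j _ => ?_
        rw [conj_diagonal_apply_self]
        have := concaveOn_negMulLog.le_map_sum (t := Finset.univ) (w := fun i => ‖W j i‖ ^ 2)
          (p := p) (fun i _ => by positivity) (sum_norm_sq_row hW1 j)
          (fun i _ => hρ.eigenvalues_nonneg i)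
        simpa [smul_eq_mul] using this

/-- Klein's inequality. -/
theorem entropy_le_neg_trace_mul_log {ρ σ : Matrix a a ℂ} (hρ : ρ.PosSemidef) (hσ : σ.PosDef) :
    entropy ρ ≤ -(ρ * cfc Real.log σ).trace.re + σ.trace.re - ρ.trace.re := by
  have hU := eigenvectorUnitary_conjTranspose_mul hσ.1
  have hU' := eigenvectorUnitary_mul_conjTranspose hσ.1
  refine (entropy_le_sum_diag hρ hU).trans ?_
  rw [eq_conj_diagonal hσ.1, trace_mul_conj_diagonal, trace_eq_sum_conj hU' ρ,
    hσ.1.trace_eq_sum_eigenvalues]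
  simp only [Complex.re_sum, ← Finset.sum_neg_distrib, ← Finset.sum_add_distrib,
    ← Finset.sum_sub_distrib, Complex.re_mul_ofReal]
  exact Finset.sum_le_sum fun j _ =>
    negMulLog_le_of_pos (diag_conj_nonneg hρ _ j) (hσ.eigenvalues_pos j)

/-! ### Elementary bounds for states. -/

theorem IsState.sum_eigenvalues {ρ : Matrix a a ℂ} (h : IsState ρ) :
    ∑ i, h.1.1.eigenvalues i = 1 := by
  have := h.2.symm.trans h.1.1.trace_eq_sum_eigenvalues
  simpa using congrArg Complex.re this.symm

theorem IsState.eigenvalues_le_one {ρ : Matrix a a ℂ} (h : IsState ρ) (i : a) :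
    h.1.1.eigenvalues i ≤ 1 := by
  rw [← h.sum_eigenvalues]
  exact Finset.single_le_sum (fun j _ => h.1.eigenvalues_nonneg j) (Finset.mem_univ i)

theorem IsState.entropy_nonneg {ρ : Matrix a a ℂ} (h : IsState ρ) : 0 ≤ entropy ρ := by
  rw [entropy_eq_sum_eigenvalues h.1.1]
  exact Finset.sum_nonneg fun i _ => negMulLog_nonneg (h.1.eigenvalues_nonneg i)
    (h.eigenvalues_le_one i)

theorem IsState.entropy_le_log_card {ρ : Matrix a a ℂ} (h : IsState ρ) :
    entropy ρ ≤ Real.log (Fintype.card a) := by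
  have hne : Nonempty a := by
    by_contra hc
    rw [not_nonempty_iff] at hc
    simpa using h.sum_eigenvalues
  have hpos : (0 : ℝ) < Fintype.card a := by exact_mod_cast Fintype.card_pos
  rw [entropy_eq_sum_eigenvalues h.1.1]
  -- Tangent at the eigenvalue 1 / card of the maximally mixed state.
  refine (Finset.sum_le_sum fun i _ => negMulLog_le_of_pos (h.1.eigenvalues_nonneg i)
    (inv_pos.mpr hpos)).trans ?_
  rw [Finset.sum_sub_distrib, Finset.sum_add_distrib, Finset.sum_neg_distrib, ← Finset.sum_mul,
    h.sum_eigenvalues]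
  simp [Real.log_inv, hpos.ne']

theorem IsState.le_one {ρ : Matrix a a ℂ} (h : IsState ρ) : ρ ≤ 1 := by
  have hU' := eigenvectorUnitary_mul_conjTranspose h.1.1
  rw [Matrix.le_iff]
  have : 1 - ρ = (h.1.1.eigenvectorUnitary : Matrix a a ℂ) *
      diagonal (fun i => ((1 - h.1.1.eigenvalues i : ℝ) : ℂ)) *
      (h.1.1.eigenvectorUnitary : Matrix a a ℂ)ᴴ := by
    conv_lhs => rw [eq_conj_diagonal_eigenvalues h.1.1, ← hU']
    have : diagonal (fun i => ((1 - h.1.1.eigenvalues i : ℝ) : ℂ)) =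
        (1 : Matrix a a ℂ) - diagonal (fun i => ((h.1.1.eigenvalues i : ℝ) : ℂ)) := by
      rw [← diagonal_one, diagonal_sub]; simp
    rw [this, Matrix.mul_sub, Matrix.sub_mul, Matrix.mul_one]
  rw [this]
  refine Matrix.PosSemidef.mul_mul_conjTranspose_same (PosSemidef.diagonal fun i => ?_) _
  have := h.eigenvalues_le_one i
  simpa using (Complex.zero_le_real.mpr (sub_nonneg.mpr this))

theorem IsState.mix {ρ σ : Matrix a a ℂ} (hρ : IsState ρ) (hσ : IsState σ) {ε : ℝ}
    (h0 : 0 ≤ ε) (h1 : ε ≤ 1) : IsState (((1 - ε : ℝ) : ℂ) • ρ + (ε : ℂ) • σ) := by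
  refine ⟨(hρ.1.smul ?_).add (hσ.1.smul ?_), ?_⟩
  · exact Complex.zero_le_real.mpr (sub_nonneg.mpr h1)
  · exact Complex.zero_le_real.mpr h0
  · simp [hρ.2, hσ.2]

/-! ### Range projections and traces of products. -/

/-- An orthogonal projection `E` with `E A = A` and `E = A X` is the range projection of `A`. -/
theorem rangeProjection_eq_of_mul {A E X : Matrix a a ℂ} (hE : E.IsHermitian)
    (hEA : E * A = A) (hX : E = A * X) : rangeProjection A = E := by
  have hsa : IsSelfAdjoint (Matrix.toEuclideanCLM (n := a) (𝕜 := ℂ) E) := by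
    have : IsSelfAdjoint E := hE
    exact this.map _
  have hEE : E * E = E := by
    nth_rw 2 [hX]
    rw [← Matrix.mul_assoc, hEA, ← hX]
  have hproj : IsStarProjection (Matrix.toEuclideanCLM (n := a) (𝕜 := ℂ) E) :=
    ⟨by rw [IsIdempotentElem, ← map_mul, hEE], hsa⟩
  obtain ⟨K, hK, hK'⟩ := isStarProjection_iff_eq_starProjection.mp hproj
  have hrange : LinearMap.range (Matrix.toEuclideanLin A) = K := by
    have h1 : K = LinearMap.range (Matrix.toEuclideanLin E) := by
      rw [← Matrix.coe_toEuclideanCLM_eq_toEuclideanLin, hK']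
      exact (Submodule.range_starProjection K).symm
    rw [h1]
    apply le_antisymm
    · conv_lhs => rw [← hEA]
      rw [Matrix.toLpLin_mul_same]
      exact LinearMap.range_comp_le_range _ _
    · rw [hX, Matrix.toLpLin_mul_same]
      exact LinearMap.range_comp_le_range _ _
  subst hrange
  rw [rangeProjection, StarAlgEquiv.symm_apply_eq, hK']

theorem rangeProjection_eq {A : Matrix a a ℂ} (hA : A.IsHermitian) :
    rangeProjection A = (hA.eigenvectorUnitary : Matrix a a ℂ) *
      diagonal (fun i => if hA.eigenvalues i = 0 then 0 else 1) *
      (hA.eigenvectorUnitary : Matrix a a ℂ)ᴴ := by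
  set U := (hA.eigenvectorUnitary : Matrix a a ℂ) with hU
  have h1 : Uᴴ * U = 1 := eigenvectorUnitary_conjTranspose_mul hA
  have hmul : ∀ D D' : Matrix a a ℂ, (U * D * Uᴴ) * (U * D' * Uᴴ) = U * (D * D') * Uᴴ := by
    intro D D'
    rw [Matrix.mul_assoc, ← Matrix.mul_assoc Uᴴ, ← Matrix.mul_assoc Uᴴ, h1, Matrix.one_mul]
    simp only [Matrix.mul_assoc]
  have hAU : A = U * diagonal (fun i => ((hA.eigenvalues i : ℝ) : ℂ)) * Uᴴ :=
    eq_conj_diagonal_eigenvalues hA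
  -- With `0⁻¹ = 0`, this `X` is the pseudo-inverse of `A`.
  refine rangeProjection_eq_of_mul (X := U * diagonal
    (fun i => ((hA.eigenvalues i : ℝ) : ℂ)⁻¹) * Uᴴ) ?_ ?_ ?_
  · refine Matrix.isHermitian_mul_mul_conjTranspose _ ?_
    rw [Matrix.isHermitian_diagonal_iff]
    intro i
    split_ifs <;> simp [IsSelfAdjoint]
  · generalize hA.eigenvalues = p at *
    rw [hAU, hmul, diagonal_mul_diagonal]
    congr 3
    ext i
    split_ifs with h <;> simp [h]
  · generalize hA.eigenvalues = p at *
    conv_rhs => rw [hAU, hmul, diagonal_mul_diagonal]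
    congr 3
    ext i
    split_ifs with h <;> simp [h]

theorem trace_mul_nonneg {A B : Matrix a a ℂ} (hA : A.PosSemidef) (hB : B.PosSemidef) :
    0 ≤ (A * B).trace.re := by
  conv_rhs => rw [eq_conj_diagonal_eigenvalues hB.1]
  rw [trace_mul_conj_diagonal, Complex.re_sum]
  refine Finset.sum_nonneg fun i _ => ?_
  rw [Complex.re_mul_ofReal]
  exact mul_nonneg (diag_conj_nonneg hA _ i) (hB.eigenvalues_nonneg i)

theorem trace_mul_le_trace_mul {A L N : Matrix a a ℂ} (hA : A.PosSemidef) (h : L ≤ N) :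
    (A * L).trace.re ≤ (A * N).trace.re := by
  have := trace_mul_nonneg hA (Matrix.le_iff.mp h)
  rw [Matrix.mul_sub, Matrix.trace_sub, Complex.sub_re] at this
  linarith

/-- This writes the coefficient of the singularity as the diagonal weight of `B` on the kernel of
`A`, ready for comparison term by term. -/
theorem one_sub_trace_mul_rangeProjection {A B : Matrix a a ℂ} (hA : A.IsHermitian)
    (hB : B.trace = 1) :
    1 - (B * rangeProjection A).trace.re = ∑ i, if hA.eigenvalues i = 0 then
      (((hA.eigenvectorUnitary : Matrix a a ℂ)ᴴ * B *
        (hA.eigenvectorUnitary : Matrix a a ℂ)) i i).re else 0 := by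
  have h1 := congrArg Complex.re
    (hB.symm.trans (trace_eq_sum_conj (eigenvectorUnitary_mul_conjTranspose hA) B))
  rw [Complex.one_re, Complex.re_sum] at h1
  rw [rangeProjection_eq hA, trace_mul_conj_diagonal, h1, Complex.re_sum,
    ← Finset.sum_sub_distrib]
  refine Finset.sum_congr rfl fun i _ => ?_
  split_ifs <;> simp

/-! ### The entropy near a state, up to order ε. -/

/-- Upper bound on the entropy of a small perturbation of a state, with the exact coefficient of
the logarithmic singularity. -/
theorem entropy_mix_le {A B : Matrix a a ℂ} (hA : IsState A) (hB : IsState B) :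
    ∃ C : ℝ, ∀ ε : ℝ, 0 < ε → ε < 1 →
      entropy (((1 - ε : ℝ) : ℂ) • A + (ε : ℂ) • B) ≤
        entropy A + ε * -Real.log ε * (1 - (B * rangeProjection A).trace.re) + C * ε := by
  have hU := eigenvectorUnitary_conjTranspose_mul hA.1.1
  have hD := conj_eq_of_eq_conj hU (eq_conj_diagonal_eigenvalues hA.1.1)
  rw [one_sub_trace_mul_rangeProjection hA.1.1 hB.2, entropy_eq_sum_eigenvalues hA.1.1]
  have hp := hA.1.eigenvalues_nonneg
  have hb := diag_conj_nonneg hB.1 (hA.1.1.eigenvectorUnitary : Matrix a a ℂ)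
  generalize (hA.1.1.eigenvectorUnitary : Matrix a a ℂ) = U at *
  generalize hA.1.1.eigenvalues = p at *
  -- Write y for the i-th diagonal entry of B. On the kernel the product rule for -x log x is exact:
  -- -εy log(εy) = ε(-y log y) + y(-ε log ε). Elsewhere the tangent at `p i` costs ε(p i - y)(log(p
  -- i) + 1).
  refine ⟨∑ i, if p i = 0 then negMulLog ((Uᴴ * B * U) i i).re else
    (p i - ((Uᴴ * B * U) i i).re) * (Real.log (p i) + 1), fun ε h0 h1 => ?_⟩
  refine (entropy_le_sum_diag (hA.mix hB h0.le h1.le).1 hU).trans ?_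
  rw [Finset.mul_sum, Finset.sum_mul, ← Finset.sum_add_distrib, ← Finset.sum_add_distrib]
  refine Finset.sum_le_sum fun i _ => ?_
  have hentry : ((Uᴴ * (((1 - ε : ℝ) : ℂ) • A + (ε : ℂ) • B) * U) i i).re =
      (1 - ε) * p i + ε * ((Uᴴ * B * U) i i).re := by
    rw [Matrix.mul_add, Matrix.add_mul, Matrix.mul_smul, Matrix.mul_smul, Matrix.smul_mul,
      Matrix.smul_mul, hD]
    simp only [Matrix.add_apply, Matrix.smul_apply, diagonal_apply_eq, smul_eq_mul, Complex.add_re,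
      Complex.re_ofReal_mul, Complex.ofReal_re]
  rw [hentry]
  have hbi := hb i
  generalize ((Uᴴ * B * U) i i).re = y at *
  split_ifs with h
  · rw [h, mul_zero, zero_add, negMulLog_mul, negMulLog_zero]
    apply le_of_eq
    rw [negMulLog]
    ring
  · have hpi : 0 < p i := lt_of_le_of_ne (hp i) (Ne.symm h)
    refine (negMulLog_le_of_pos (by nlinarith [mul_nonneg h0.le hbi]) hpi).trans (le_of_eq ?_)
    rw [negMulLog]
    ring

/-- The two matrices commute, so monotonicity of log applies to each eigenvalue; zero eigenvalues of
`ρ` contribute nothing to either side. The shift by ε makes the logarithm's argument positive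
definite, as Klein's inequality and operator monotonicity require. -/
theorem neg_trace_mul_log_add_le_entropy {ρ : Matrix a a ℂ} (hρ : ρ.PosSemidef) {ε : ℝ}
    (hε : 0 < ε) :
    -(ρ * cfc Real.log (ρ + (ε : ℂ) • (1 : Matrix a a ℂ))).trace.re ≤ entropy ρ := by
  obtain ⟨σ, hσ⟩ : ∃ σ, σ = ρ + (ε : ℂ) • (1 : Matrix a a ℂ) := ⟨_, rfl⟩
  have hH : σ.IsHermitian := by
    rw [hσ]
    refine hρ.1.add ?_
    simp [Matrix.IsHermitian, conjTranspose_smul]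
  have hU := eigenvectorUnitary_conjTranspose_mul hH
  have hU' := eigenvectorUnitary_mul_conjTranspose hH
  rw [← hσ, eq_conj_diagonal hH, trace_mul_conj_diagonal]
  have hσd := eq_conj_diagonal_eigenvalues hH
  generalize (hH.eigenvectorUnitary : Matrix a a ℂ) = U at *
  generalize hH.eigenvalues = s at *
  have hρd : ρ = U * diagonal (fun i => ((s i - ε : ℝ) : ℂ)) * Uᴴ := by
    have : diagonal (fun i => ((s i - ε : ℝ) : ℂ)) =
        diagonal (fun i => ((s i : ℝ) : ℂ)) - (ε : ℂ) • (1 : Matrix a a ℂ) := by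
      rw [smul_one_eq_diagonal, diagonal_sub]; simp
    rw [this, Matrix.mul_sub, Matrix.sub_mul, ← hσd, hσ, Matrix.mul_smul, Matrix.mul_one,
      Matrix.smul_mul, hU', add_sub_cancel_right]
  have hd := conj_eq_of_eq_conj hU hρd
  have hnn : ∀ i, 0 ≤ s i - ε := by
    intro i
    have := diag_conj_nonneg hρ U i
    simpa [hd] using this
  rw [hd]
  conv_rhs => rw [hρd]
  rw [entropy_conj_diagonal hU, Complex.re_sum, ← Finset.sum_neg_distrib]
  refine Finset.sum_le_sum fun i _ => ?_
  rw [diagonal_apply_eq, ← Complex.ofReal_mul, Complex.ofReal_re, negMulLog, neg_mul, neg_le_neg_iff]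
  rcases (hnn i).eq_or_lt with h | h
  · simp [← h]
  · exact mul_le_mul_of_nonneg_left (Real.log_le_log h (by linarith)) h.le

section OperatorMonotone

open scoped Matrix.Norms.L2Operator

theorem cfc_log_le_cfc_log {σ N : Matrix a a ℂ} (hσ : σ.PosDef) (h : σ ≤ N) :
    cfc Real.log σ ≤ cfc Real.log N :=
  CFC.log_le_log h (Matrix.isStrictlyPositive_iff_posDef.mpr hσ)

end OperatorMonotone

theorem rangeProjection_eq_cfc {A : Matrix a a ℂ} (hA : A.IsHermitian) :
    rangeProjection A = cfc (fun x : ℝ => if x = 0 then 0 else 1) A := by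
  rw [rangeProjection_eq hA, eq_conj_diagonal hA]
  congr 3
  ext i
  split_ifs <;> simp

/-- The spectrum is finite, so the functional calculus also accepts the discontinuous indicators
used for range projections. -/
theorem continuousOn_spectrum (A : Matrix a a ℂ) (f : ℝ → ℝ) : ContinuousOn f (spectrum ℝ A) :=
  Matrix.finite_real_spectrum.continuousOn f

theorem rangeProjection_isHermitian {A : Matrix a a ℂ} (hA : A.IsHermitian) :
    (rangeProjection A).IsHermitian := by
  rw [rangeProjection_eq_cfc hA]
  exact cfc_predicate _ A

theorem rangeProjection_mul_self {A : Matrix a a ℂ} (hA : A.IsHermitian) :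
    rangeProjection A * rangeProjection A = rangeProjection A := by
  rw [rangeProjection_eq_cfc hA, ← cfc_mul _ _ A (continuousOn_spectrum A _)
    (continuousOn_spectrum A _)]
  congr 1
  ext x
  split_ifs <;> simp

theorem rangeProjection_mul {A : Matrix a a ℂ} (hA : A.IsHermitian) :
    rangeProjection A * A = A := by
  have hA' : IsSelfAdjoint A := hA
  have h := cfc_mul (fun x : ℝ => if x = 0 then 0 else 1) id A (continuousOn_spectrum A _)
    (continuousOn_spectrum A _)
  rw [cfc_id ℝ A] at h
  rw [rangeProjection_eq_cfc hA, ← h]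
  conv_rhs => rw [← cfc_id ℝ A]
  congr 1
  ext x
  split_ifs <;> simp [*]

theorem mul_rangeProjection {A : Matrix a a ℂ} (hA : A.IsHermitian) :
    A * rangeProjection A = A := by
  have := congrArg conjTranspose (rangeProjection_mul hA)
  rwa [conjTranspose_mul, (rangeProjection_isHermitian hA).eq, hA.eq] at this

/-- A mixture `(1 - ε) A + ε B` is dominated, up to a constant factor, by `ε` off the range of
`A`. -/
theorem mix_add_le {A B : Matrix a a ℂ} (hA : IsState A) (hB : IsState B) {ε : ℝ}
    (h0 : 0 < ε) (h1 : ε < 1) :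
    ((1 - ε : ℝ) : ℂ) • A + (ε : ℂ) • B + (ε : ℂ) • (1 : Matrix a a ℂ) ≤
      cfc (fun x : ℝ => if x = 0 then 3 * ε else 3) A := by
  have hA' : IsSelfAdjoint A := hA.1.1
  have hN : cfc (fun x : ℝ => if x = 0 then 3 * ε else 3) A =
      (3 * (1 - ε : ℝ) : ℂ) • rangeProjection A + (3 * ε : ℂ) • (1 : Matrix a a ℂ) := by
    have h := cfc_add A (fun x : ℝ => (3 * (1 - ε)) • (if x = 0 then 0 else 1 : ℝ))
      (fun x : ℝ => (3 * ε)) (continuousOn_spectrum A _) (continuousOn_spectrum A _)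
    rw [cfc_smul (3 * (1 - ε)) _ A (continuousOn_spectrum A _), cfc_const _ A,
      ← rangeProjection_eq_cfc hA.1.1, Algebra.algebraMap_eq_smul_one] at h
    rw [← Complex.coe_smul, ← Complex.coe_smul] at h
    push_cast at h ⊢
    rw [← h]
    congr 1
    ext x
    split_ifs <;> simp
    ring
  have hPP := rangeProjection_mul_self hA.1.1
  have hPA := rangeProjection_mul hA.1.1
  have hAP := mul_rangeProjection hA.1.1
  have hPH := rangeProjection_isHermitian hA.1.1
  have hρ := hA.mix hB h0.le h1.le
  rw [hN, Matrix.le_iff]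
  set P := rangeProjection A with hP
  have hε : (0 : ℂ) ≤ (ε : ℂ) := Complex.zero_le_real.mpr h0.le
  have hε' : (0 : ℂ) ≤ ((1 - ε : ℝ) : ℂ) := Complex.zero_le_real.mpr (by linarith)
  have hQH : (1 - P).IsHermitian := Matrix.isHermitian_one.sub hPH
  have hconj : ∀ {M Q : Matrix a a ℂ}, M.PosSemidef → Q.IsHermitian → (Q * M * Q).PosSemidef := by
    intro M Q hM hQ
    simpa [hQ.eq] using hM.mul_mul_conjTranspose_same Q
  -- Let Q = 1 - P and let ρ be the mixture. Since (P-Q)ρ(P-Q) ≥ 0, the pinching bound ρ ≤ 2PρP +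
  -- 2QρQ holds. Here QρQ = εQBQ because QA = 0, so ρ ≤ 2P + 2εQ; adding ε(P+Q) and (1-ε)P gives 3P
  -- + 3εQ. The four terms are the successive slacks.
  have t1 := hconj hρ.1 (hPH.sub hQH)
  have t2 := (hconj (Matrix.le_iff.mp hρ.le_one) hPH).smul (zero_le_two (α := ℂ))
  have t3 := ((hconj (Matrix.le_iff.mp hB.le_one) hQH).smul hε).smul (zero_le_two (α := ℂ))
  have t4 := (hconj PosSemidef.one hPH).smul hε'
  have t := ((t1.add t2).add t3).add t4
  refine (congrArg PosSemidef ?_).mpr t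
  simp only [Matrix.mul_sub, Matrix.sub_mul, Matrix.mul_add, Matrix.add_mul, Matrix.mul_one,
    Matrix.one_mul, Matrix.mul_smul, Matrix.smul_mul, Matrix.mul_assoc, hPP, hPA, hAP]
  push_cast
  module

theorem posDef_add_smul_one {ρ : Matrix a a ℂ} (hρ : ρ.PosSemidef) {ε : ℝ} (h0 : 0 < ε) :
    (ρ + (ε : ℂ) • (1 : Matrix a a ℂ)).PosDef :=
  PosDef.posSemidef_add hρ (PosDef.one.smul (Complex.zero_lt_real.mpr h0))

/-- Lower bound on the entropy of a small perturbation of a state, with the exact coefficient of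
the logarithmic singularity. -/
theorem le_entropy_mix {A B : Matrix a a ℂ} (hA : IsState A) (hB : IsState B) :
    ∃ C : ℝ, ∀ ε : ℝ, 0 < ε → ε < 1 →
      entropy A + ε * -Real.log ε * (1 - (B * rangeProjection A).trace.re) - C * ε ≤
        entropy (((1 - ε : ℝ) : ℂ) • A + (ε : ℂ) • B) := by
  -- Split -Tr(ρ log σ), with σ = ρ + ε, along ρ = (1-ε)A + εB. Klein's inequality on the `A` part
  -- loses at most ε(S(A) + card a); operator monotonicity on the `B` part gives the singular term
  -- and loses ε log 3.
  refine ⟨entropy A + Fintype.card a + Real.log 3, fun ε h0 h1 => ?_⟩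
  have hA' : IsSelfAdjoint A := hA.1.1
  have hρ := hA.mix hB h0.le h1.le
  have hσ := posDef_add_smul_one hρ.1 h0
  refine le_trans ?_ (neg_trace_mul_log_add_le_entropy hρ.1 h0)
  have hKlein := entropy_le_neg_trace_mul_log hA.1 hσ
  have hmono := trace_mul_le_trace_mul hB.1 (cfc_log_le_cfc_log hσ (mix_add_le hA hB h0 h1))
  have hlogN : cfc Real.log (cfc (fun x : ℝ => if x = 0 then 3 * ε else 3) A) =
      ((Real.log 3 + Real.log ε : ℝ) : ℂ) • (1 : Matrix a a ℂ) -
        (Real.log ε : ℂ) • rangeProjection A := by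
    rw [← cfc_comp' Real.log _ A ((Matrix.finite_real_spectrum.image _).continuousOn _)
      (continuousOn_spectrum A _)]
    have h := cfc_sub (fun x : ℝ => Real.log 3 + Real.log ε)
      (fun x : ℝ => Real.log ε • (if x = 0 then 0 else 1 : ℝ)) A
      (continuousOn_spectrum A _) (continuousOn_spectrum A _)
    rw [cfc_smul (Real.log ε) _ A (continuousOn_spectrum A _), cfc_const _ A,
      ← rangeProjection_eq_cfc hA.1.1, Algebra.algebraMap_eq_smul_one,
      ← Complex.coe_smul, ← Complex.coe_smul] at h
    rw [← h]
    congr 1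
    ext x
    split_ifs
    · simp [Real.log_mul, h0.ne']
    · simp
  have htr : (((1 - ε : ℝ) : ℂ) • A + (ε : ℂ) • B + (ε : ℂ) • (1 : Matrix a a ℂ)).trace.re =
      1 + ε * Fintype.card a := by
    rw [Matrix.trace_add, hρ.2, Matrix.trace_smul, Matrix.trace_one]
    simp
  rw [hlogN, Matrix.mul_sub, Matrix.mul_smul, Matrix.mul_smul, Matrix.mul_one, Matrix.trace_sub,
    Matrix.trace_smul, Matrix.trace_smul, hB.2, smul_eq_mul, mul_one, smul_eq_mul,
    Complex.sub_re, Complex.ofReal_re, Complex.re_ofReal_mul] at hmono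
  rw [htr, hA.2, Complex.one_re] at hKlein
  generalize ((1 - ε : ℝ) : ℂ) • A + (ε : ℂ) • B + (ε : ℂ) • (1 : Matrix a a ℂ) = σ at *
  rw [Matrix.add_mul, Matrix.smul_mul, Matrix.smul_mul, Matrix.trace_add, Matrix.trace_smul,
    Matrix.trace_smul, smul_eq_mul, smul_eq_mul, Complex.add_re, Complex.re_ofReal_mul,
    Complex.re_ofReal_mul]
  have e1 := mul_le_mul_of_nonneg_left hKlein (by linarith : 0 ≤ 1 - ε)
  have e2 := mul_le_mul_of_nonneg_left hmono h0.le
  have e3 : 0 ≤ ε * ε * (Fintype.card a : ℝ) := by positivity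
  nlinarith [e1, e2, e3]

/-- If the entropy of a perturbation of `A` never exceeds that of the perturbation of `A'`, and
`A'` has no more entropy than `A`, then the perturbation has at most as much weight off the range of
`A` as it has off the range of `A'`. -/
theorem trace_mul_rangeProjection_le {A B : Matrix a a ℂ} {A' B' : Matrix b b ℂ}
    (hA : IsState A) (hB : IsState B) (hA' : IsState A') (hB' : IsState B')
    (hS : entropy A' ≤ entropy A)
    (h : ∀ ε : ℝ, 0 < ε → ε < 1 → entropy (((1 - ε : ℝ) : ℂ) • A + (ε : ℂ) • B) ≤
      entropy (((1 - ε : ℝ) : ℂ) • A' + (ε : ℂ) • B')) :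
    (B' * rangeProjection A').trace.re ≤ (B * rangeProjection A).trace.re := by
  obtain ⟨C, hC⟩ := le_entropy_mix hA hB
  obtain ⟨C', hC'⟩ := entropy_mix_le hA' hB'
  by_contra! hlt
  set δ := (B' * rangeProjection A').trace.re - (B * rangeProjection A).trace.re with hδ
  have hδ0 : 0 < δ := sub_pos.mpr hlt
  obtain ⟨ε, h0, h1, hL⟩ : ∃ ε : ℝ, 0 < ε ∧ ε < 1 ∧ (C + C') < -Real.log ε * δ := by
    -- Chosen so that -log ε · δ = |C + C'| + 1: the singular term beats both O(ε) errors.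
    refine ⟨Real.exp (-((|C + C'| + 1) / δ)), Real.exp_pos _, ?_, ?_⟩
    · rw [Real.exp_lt_one_iff]
      exact neg_lt_zero.mpr (by positivity)
    · rw [Real.log_exp, neg_neg, div_mul_cancel₀ _ hδ0.ne']
      linarith [le_abs_self (C + C')]
  have := (hC ε h0 h1).trans ((h ε h0 h1).trans (hC' ε h0 h1))
  nlinarith [mul_lt_mul_of_pos_left hL h0]

/-! ### Partial traces and complementary pairs. -/

theorem traceSnd_posSemidef {M : Matrix (b × e) (b × e) ℂ} (hM : M.PosSemidef) :
    (traceSnd M).PosSemidef := by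
  have : traceSnd M = ∑ k, M.submatrix (fun i => (i, k)) (fun i => (i, k)) := by
    ext i j
    simp [traceSnd, Matrix.sum_apply]
  rw [this]
  exact posSemidef_sum _ fun k _ => hM.submatrix _

theorem traceFst_posSemidef {M : Matrix (b × e) (b × e) ℂ} (hM : M.PosSemidef) :
    (traceFst M).PosSemidef := by
  have : traceFst M = ∑ k, M.submatrix (fun i => (k, i)) (fun i => (k, i)) := by
    ext i j
    simp [traceFst, Matrix.sum_apply]
  rw [this]
  exact posSemidef_sum _ fun k _ => hM.submatrix _

theorem trace_traceSnd (M : Matrix (b × e) (b × e) ℂ) : (traceSnd M).trace = M.trace := by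
  simp [traceSnd, Matrix.trace, Fintype.sum_prod_type]

theorem trace_traceFst (M : Matrix (b × e) (b × e) ℂ) : (traceFst M).trace = M.trace := by
  simp [traceFst, Matrix.trace, Fintype.sum_prod_type_right]

theorem IsState.conj_isometry {ρ : Matrix a a ℂ} (hρ : IsState ρ) {V : Matrix b a ℂ}
    (hV : Vᴴ * V = 1) : IsState (V * ρ * Vᴴ) := by
  refine ⟨hρ.1.mul_mul_conjTranspose_same V, ?_⟩
  rw [Matrix.mul_assoc, Matrix.trace_mul_comm, Matrix.mul_assoc, hV, Matrix.mul_one, hρ.2]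

theorem IsComplementary.isState_fst {Φ : Matrix a a ℂ →ₗ[ℂ] Matrix b b ℂ}
    {Φc : Matrix a a ℂ →ₗ[ℂ] Matrix e e ℂ} (h : IsComplementary Φ Φc) {ρ : Matrix a a ℂ}
    (hρ : IsState ρ) : IsState (Φ ρ) := by
  obtain ⟨V, hV, h⟩ := h
  rw [(h ρ).1]
  exact ⟨traceSnd_posSemidef (hρ.conj_isometry hV).1,
    (trace_traceSnd _).trans (hρ.conj_isometry hV).2⟩

theorem IsComplementary.isState_snd {Φ : Matrix a a ℂ →ₗ[ℂ] Matrix b b ℂ}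
    {Φc : Matrix a a ℂ →ₗ[ℂ] Matrix e e ℂ} (h : IsComplementary Φ Φc) {ρ : Matrix a a ℂ}
    (hρ : IsState ρ) : IsState (Φc ρ) := by
  obtain ⟨V, hV, h⟩ := h
  rw [(h ρ).2]
  exact ⟨traceFst_posSemidef (hρ.conj_isometry hV).1,
    (trace_traceFst _).trans (hρ.conj_isometry hV).2⟩

theorem ketbra_posSemidef (ψ : a → ℂ) : (ketbra ψ).PosSemidef := posSemidef_vecMulVec_self_star ψ

theorem IsUnitVector.isState_ketbra {ψ : a → ℂ} (h : IsUnitVector ψ) : IsState (ketbra ψ) :=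
  ⟨ketbra_posSemidef ψ, by rw [ketbra, trace_vecMulVec, dotProduct_comm]; exact h⟩

theorem conj_ketbra (V : Matrix b a ℂ) (ψ : a → ℂ) : V * ketbra ψ * Vᴴ = ketbra (V *ᵥ ψ) := by
  rw [ketbra, ketbra, mul_vecMulVec, vecMulVec_mul, star_mulVec]

/-- The two characteristic polynomials agree up to powers of X, and the extra zero roots carry no
entropy since -0 log 0 = 0. -/
theorem entropy_mul_conjTranspose_comm (M : Matrix b e ℂ) :
    entropy (M * Mᴴ) = entropy (Mᴴ * M) := by
  have h := congrArg (fun p : Polynomial ℂ => (p.roots.map fun z => negMulLog z.re).sum)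
    (Matrix.charpoly_mul_comm' M Mᴴ)
  have hX : ∀ n : ℕ, (Polynomial.X ^ n : Polynomial ℂ) ≠ 0 :=
    fun n => pow_ne_zero n Polynomial.X_ne_zero
  rw [Polynomial.roots_mul (mul_ne_zero (hX _) (charpoly_monic _).ne_zero),
    Polynomial.roots_mul (mul_ne_zero (hX _) (charpoly_monic _).ne_zero), Polynomial.roots_X_pow,
    Polynomial.roots_X_pow] at h
  rw [entropy_eq_sum_roots (isHermitian_mul_conjTranspose_self M),
    entropy_eq_sum_roots (isHermitian_conjTranspose_mul_self M)]
  simpa [Multiset.map_nsmul, Multiset.sum_nsmul] using h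

theorem entropy_transpose {ρ : Matrix a a ℂ} (h : ρ.IsHermitian) : entropy ρᵀ = entropy ρ := by
  rw [entropy_eq_sum_roots h, entropy_eq_sum_roots h.transpose, charpoly_transpose]

/-- The two marginals of a pure state have the same entropy. -/
theorem entropy_traceSnd_ketbra (w : b × e → ℂ) :
    entropy (traceSnd (ketbra w)) = entropy (traceFst (ketbra w)) := by
  -- Reshaping the vector into a matrix turns its marginals into M Mᴴ and (Mᴴ M)ᵀ, as in the Schmidt
  -- decomposition.
  let M : Matrix b e ℂ := of fun i k => w (i, k)
  have h1 : traceSnd (ketbra w) = M * Mᴴ := by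
    ext i j
    simp [traceSnd, ketbra, M, mul_apply, vecMulVec_apply]
  have h2 : traceFst (ketbra w) = (Mᴴ * M)ᵀ := by
    ext i j
    simp [traceFst, ketbra, M, mul_apply, vecMulVec_apply, mul_comm]
  rw [h1, h2, entropy_transpose (isHermitian_conjTranspose_mul_self M),
    entropy_mul_conjTranspose_comm]

theorem IsComplementary.entropy_ketbra {Φ : Matrix a a ℂ →ₗ[ℂ] Matrix b b ℂ}
    {Φc : Matrix a a ℂ →ₗ[ℂ] Matrix e e ℂ} (h : IsComplementary Φ Φc) (ψ : a → ℂ) :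
    entropy (Φ (ketbra ψ)) = entropy (Φc (ketbra ψ)) := by
  obtain ⟨V, -, h⟩ := h
  rw [(h _).1, (h _).2, conj_ketbra, entropy_traceSnd_ketbra]

/-! ### Entropy of reindexed and product states. -/

theorem entropy_submatrix_equiv {ρ : Matrix a a ℂ} (h : ρ.IsHermitian) (f : b ≃ a) :
    entropy (ρ.submatrix f f) = entropy ρ := by
  rw [entropy_eq_sum_roots h, entropy_eq_sum_roots (h.submatrix f)]
  have := charpoly_reindex f.symm ρ
  rw [reindex_apply, Equiv.symm_symm] at this
  rw [this]

theorem IsState.submatrix_equiv {ρ : Matrix a a ℂ} (h : IsState ρ) (f : b ≃ a) :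
    IsState (ρ.submatrix f f) :=
  ⟨h.1.submatrix f, by rw [← h.2]; exact f.sum_comp fun i => ρ i i⟩

theorem IsState.kronecker {ρ : Matrix a a ℂ} {σ : Matrix b b ℂ} (hρ : IsState ρ)
    (hσ : IsState σ) : IsState (ρ ⊗ₖ σ) :=
  ⟨hρ.1.kronecker hσ.1, by rw [trace_kronecker, hρ.2, hσ.2, one_mul]⟩

theorem entropy_kronecker {ρ : Matrix a a ℂ} {σ : Matrix b b ℂ} (hρ : IsState ρ)
    (hσ : IsState σ) : entropy (ρ ⊗ₖ σ) = entropy ρ + entropy σ := by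
  have hU := eigenvectorUnitary_conjTranspose_mul hρ.1.1
  have hW := eigenvectorUnitary_conjTranspose_mul hσ.1.1
  rw [entropy_eq_sum_eigenvalues hρ.1.1, entropy_eq_sum_eigenvalues hσ.1.1]
  have hρd := eq_conj_diagonal_eigenvalues hρ.1.1
  have hσd := eq_conj_diagonal_eigenvalues hσ.1.1
  have hp := hρ.sum_eigenvalues
  have hq := hσ.sum_eigenvalues
  generalize (hρ.1.1.eigenvectorUnitary : Matrix a a ℂ) = U at *
  generalize (hσ.1.1.eigenvectorUnitary : Matrix b b ℂ) = W at *
  generalize hρ.1.1.eigenvalues = p at *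
  generalize hσ.1.1.eigenvalues = q at *
  have h : ρ ⊗ₖ σ = (U ⊗ₖ W) * diagonal (fun i : a × b => ((p i.1 * q i.2 : ℝ) : ℂ)) *
      (U ⊗ₖ W)ᴴ := by
    have : diagonal (fun i : a × b => ((p i.1 * q i.2 : ℝ) : ℂ)) =
        diagonal (fun i => (p i : ℂ)) ⊗ₖ diagonal (fun i => (q i : ℂ)) := by
      rw [diagonal_kronecker_diagonal]; simp
    rw [this, conjTranspose_kronecker, ← mul_kronecker_mul, ← mul_kronecker_mul, ← hρd, ← hσd]
  rw [h, entropy_conj_diagonal, Fintype.sum_prod_type]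
  · simp only [negMulLog_mul, Finset.sum_add_distrib, ← Finset.sum_mul, ← Finset.mul_sum, hp, hq,
      one_mul]
  · rw [conjTranspose_kronecker, ← mul_kronecker_mul, hU, hW, one_kronecker_one]

/-! ### Tensor powers and complementarity. -/

theorem conj_isometry_apply {c : Type*} (V : Matrix c a ℂ) (X : Matrix a a ℂ) (x y : c) :
    (V * X * Vᴴ) x y = ∑ h, ∑ k, X h k * (V x h * star (V y k)) := by
  simp only [mul_apply, conjTranspose_apply, Finset.sum_mul]
  rw [Finset.sum_comm]
  exact Finset.sum_congr rfl fun h _ => Finset.sum_congr rfl fun k _ => by ring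

theorem conj_isometry_single_apply {c : Type*} (V : Matrix c a ℂ) (p q : a) (x y : c) :
    (V * single p q (1 : ℂ) * Vᴴ) x y = V x p * star (V y q) := by
  rw [conj_isometry_apply]
  simp [single_apply, ite_and]

/-- The tensor power of an isometry into a bipartite space. -/
def tensorIsometry (V : Matrix (b × e) a ℂ) (n : ℕ) :
    Matrix ((Fin n → b) × (Fin n → e)) (Fin n → a) ℂ :=
  of fun x h => ∏ i, V (x.1 i, x.2 i) (h i)

theorem tensorIsometry_conjTranspose_mul {V : Matrix (b × e) a ℂ} (hV : Vᴴ * V = 1) (n : ℕ) :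
    (tensorIsometry V n)ᴴ * tensorIsometry V n = 1 := by
  ext h k
  have : ∀ i, ∑ x, star (V x (h i)) * V x (k i) = (1 : Matrix a a ℂ) (h i) (k i) := by
    intro i
    rw [← hV, mul_apply]
    rfl
  calc _ = ∑ x : (Fin n → b) × (Fin n → e),
        ∏ i, (star (V (x.1 i, x.2 i) (h i)) * V (x.1 i, x.2 i) (k i)) := by
        simp [tensorIsometry, mul_apply, Finset.prod_mul_distrib]
    _ = ∑ x : Fin n → b × e, ∏ i, (star (V (x i) (h i)) * V (x i) (k i)) :=
        ((Equiv.arrowProdEquivProdArrow (Fin n) (fun _ => b) (fun _ => e)).sum_comp _).symm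
    _ = ∏ i, ∑ x, star (V x (h i)) * V x (k i) := by
        rw [Finset.prod_univ_sum, Fintype.piFinset_univ]
    _ = _ := by
        simp only [this, one_apply, Finset.prod_ite_zero, Finset.prod_const_one, funext_iff,
          Finset.mem_univ, true_imp_iff]

/-- Tensor powers of complementary maps are complementary. -/
theorem IsComplementary.tensorPower {Φ : Matrix a a ℂ →ₗ[ℂ] Matrix b b ℂ}
    {Φc : Matrix a a ℂ →ₗ[ℂ] Matrix e e ℂ} (h : IsComplementary Φ Φc) (n : ℕ) :
    IsComplementary (tensorPower Φ n) (tensorPower Φc n) := by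
  obtain ⟨V, hV, h⟩ := h
  refine ⟨tensorIsometry V n, tensorIsometry_conjTranspose_mul hV n, fun X => ⟨?_, ?_⟩⟩
  · have hs : ∀ p q s t, Φ (single p q 1) s t = ∑ r, V (s, r) p * star (V (t, r) q) := by
      intro p q s t
      simp only [(h _).1, traceSnd, of_apply, conj_isometry_single_apply]
    ext f f'
    simp only [traceSnd, of_apply, conj_isometry_apply, QChan.tensorPower, LinearMap.coe_mk,
      AddHom.coe_mk, Matrix.sum_apply, Matrix.smul_apply, smul_eq_mul, tensorMatrix, hs]
    symm
    rw [Finset.sum_comm]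
    refine Finset.sum_congr rfl fun p _ => ?_
    rw [Finset.sum_comm]
    refine Finset.sum_congr rfl fun q _ => ?_
    rw [← Finset.mul_sum, Finset.prod_univ_sum, Fintype.piFinset_univ]
    simp [tensorIsometry, Finset.prod_mul_distrib]
  · have hs : ∀ p q s t, Φc (single p q 1) s t = ∑ r, V (r, s) p * star (V (r, t) q) := by
      intro p q s t
      simp only [(h _).2, traceFst, of_apply, conj_isometry_single_apply]
    ext f f'
    simp only [traceFst, of_apply, conj_isometry_apply, QChan.tensorPower, LinearMap.coe_mk,
      AddHom.coe_mk, Matrix.sum_apply, Matrix.smul_apply, smul_eq_mul, tensorMatrix, hs]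
    symm
    rw [Finset.sum_comm]
    refine Finset.sum_congr rfl fun p _ => ?_
    rw [Finset.sum_comm]
    refine Finset.sum_congr rfl fun q _ => ?_
    rw [← Finset.mul_sum, Finset.prod_univ_sum, Fintype.piFinset_univ]
    simp [tensorIsometry, Finset.prod_mul_distrib]

/-! ### Joining m and n copies; additivity of coherent information. -/

/-- Splitting a function on `Fin (m + n)` into its first `m` and its last `n` values. -/
abbrev splitEquiv (a : Type*) (m n : ℕ) : (Fin (m + n) → a) ≃ (Fin m → a) × (Fin n → a) :=
  (Fin.appendEquiv m n).symm

/-- The tensor product of operators on `m` and on `n` copies, as an operator on `m + n` copies. -/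
def appendTensor {m n : ℕ} (A : Matrix (Fin m → a) (Fin m → a) ℂ)
    (B : Matrix (Fin n → a) (Fin n → a) ℂ) :
    Matrix (Fin (m + n) → a) (Fin (m + n) → a) ℂ :=
  (A ⊗ₖ B).submatrix (splitEquiv a m n) (splitEquiv a m n)

theorem appendTensor_single {m n : ℕ} (h k : Fin (m + n) → a) :
    appendTensor (single (splitEquiv a m n h).1 (splitEquiv a m n k).1 (1 : ℂ))
      (single (splitEquiv a m n h).2 (splitEquiv a m n k).2 1) = single h k 1 := by
  ext f g
  have : ∀ x y : Fin (m + n) → a, x = y ↔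
      (splitEquiv a m n x).1 = (splitEquiv a m n y).1 ∧
      (splitEquiv a m n x).2 = (splitEquiv a m n y).2 := fun x y => by
    rw [← Prod.ext_iff, (splitEquiv a m n).injective.eq_iff]
  simp only [appendTensor, submatrix_apply, kroneckerMap_apply, single_apply, this h, this k,
    mul_ite, mul_one, mul_zero]
  split_ifs <;> tauto

theorem tensorPower_appendTensor (Φ : Matrix a a ℂ →ₗ[ℂ] Matrix b b ℂ) {m n : ℕ}
    (A : Matrix (Fin m → a) (Fin m → a) ℂ) (B : Matrix (Fin n → a) (Fin n → a) ℂ) :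
    tensorPower Φ (m + n) (appendTensor A B) =
      appendTensor (tensorPower Φ m A) (tensorPower Φ n B) := by
  ext f g
  simp only [tensorPower, tensorMatrix, LinearMap.coe_mk, AddHom.coe_mk, appendTensor,
    submatrix_apply, kroneckerMap_apply, Matrix.sum_apply, Matrix.smul_apply, smul_eq_mul, of_apply,
    Fin.prod_univ_add]
  rw [← (splitEquiv a m n).symm.sum_comp]
  simp only [← (splitEquiv a m n).symm.sum_comp (fun k => _ * _), Equiv.apply_symm_apply]
  simp only [Fintype.sum_prod_type, Finset.sum_mul_sum]
  refine Finset.sum_congr rfl fun h₁ _ => ?_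
  refine Finset.sum_congr rfl fun h₂ _ => ?_
  refine Finset.sum_congr rfl fun k₁ _ => ?_
  refine Finset.sum_congr rfl fun k₂ _ => ?_
  simp [splitEquiv, Fin.appendEquiv]
  ring

/-- The tensor product of isometries on `m` and on `n` copies. -/
def appendIsometry {m n : ℕ} {E₁ E₂ : Type*} (V : Matrix ((Fin m → b) × E₁) (Fin m → a) ℂ)
    (W : Matrix ((Fin n → b) × E₂) (Fin n → a) ℂ) :
    Matrix ((Fin (m + n) → b) × (E₁ × E₂)) (Fin (m + n) → a) ℂ :=
  (V ⊗ₖ W).submatrix (((splitEquiv b m n).prodCongr (Equiv.refl _)).trans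
    (Equiv.prodProdProdComm _ _ _ _)) (splitEquiv a m n)

theorem appendIsometry_conj {m n : ℕ} {E₁ E₂ : Type*}
    (V : Matrix ((Fin m → b) × E₁) (Fin m → a) ℂ)
    (W : Matrix ((Fin n → b) × E₂) (Fin n → a) ℂ) (A : Matrix (Fin m → a) (Fin m → a) ℂ)
    (B : Matrix (Fin n → a) (Fin n → a) ℂ) :
    appendIsometry V W * appendTensor A B * (appendIsometry V W)ᴴ =
      ((V * A * Vᴴ) ⊗ₖ (W * B * Wᴴ)).submatrix
        (((splitEquiv b m n).prodCongr (Equiv.refl _)).trans (Equiv.prodProdProdComm _ _ _ _))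
        (((splitEquiv b m n).prodCongr (Equiv.refl _)).trans
          (Equiv.prodProdProdComm _ _ _ _)) := by
  rw [appendIsometry, appendTensor, conjTranspose_submatrix, submatrix_mul_equiv,
    submatrix_mul_equiv, conjTranspose_kronecker, ← mul_kronecker_mul, ← mul_kronecker_mul]

theorem appendIsometry_conjTranspose_mul {m n : ℕ} {E₁ E₂ : Type*} [Fintype E₁] [Fintype E₂]
    {V : Matrix ((Fin m → b) × E₁) (Fin m → a) ℂ} {W : Matrix ((Fin n → b) × E₂) (Fin n → a) ℂ}
    (hV : Vᴴ * V = 1) (hW : Wᴴ * W = 1) :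
    (appendIsometry V W)ᴴ * appendIsometry V W = 1 := by
  rw [appendIsometry, conjTranspose_submatrix, submatrix_mul_equiv, conjTranspose_kronecker,
    ← mul_kronecker_mul, hV, hW, one_kronecker_one, submatrix_one_equiv]

theorem traceSnd_appendIsometry_conj {m n : ℕ} {E₁ E₂ : Type*} [Fintype E₁] [Fintype E₂]
    (V : Matrix ((Fin m → b) × E₁) (Fin m → a) ℂ)
    (W : Matrix ((Fin n → b) × E₂) (Fin n → a) ℂ) (A : Matrix (Fin m → a) (Fin m → a) ℂ)
    (B : Matrix (Fin n → a) (Fin n → a) ℂ) :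
    traceSnd (appendIsometry V W * appendTensor A B * (appendIsometry V W)ᴴ) =
      appendTensor (traceSnd (V * A * Vᴴ)) (traceSnd (W * B * Wᴴ)) := by
  rw [appendIsometry_conj]
  ext f g
  simp [traceSnd, appendTensor, Fintype.sum_prod_type, Finset.sum_mul_sum]

theorem traceFst_appendIsometry_conj {m n : ℕ} {E₁ E₂ : Type*} [Fintype E₁] [Fintype E₂]
    (V : Matrix ((Fin m → b) × E₁) (Fin m → a) ℂ)
    (W : Matrix ((Fin n → b) × E₂) (Fin n → a) ℂ) (A : Matrix (Fin m → a) (Fin m → a) ℂ)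
    (B : Matrix (Fin n → a) (Fin n → a) ℂ) :
    traceFst (appendIsometry V W * appendTensor A B * (appendIsometry V W)ᴴ) =
      traceFst (V * A * Vᴴ) ⊗ₖ traceFst (W * B * Wᴴ) := by
  rw [appendIsometry_conj]
  ext f g
  simp only [traceFst, of_apply, kroneckerMap_apply, Finset.sum_mul_sum, submatrix_apply]
  rw [← Fintype.sum_prod_type', ← (splitEquiv b m n).sum_comp]
  rfl

theorem IsState.appendTensor {m n : ℕ} {ρ : Matrix (Fin m → a) (Fin m → a) ℂ}
    {σ : Matrix (Fin n → a) (Fin n → a) ℂ} (hρ : IsState ρ) (hσ : IsState σ) :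
    IsState (appendTensor ρ σ) :=
  (hρ.kronecker hσ).submatrix_equiv _

theorem entropy_appendTensor {m n : ℕ} {ρ : Matrix (Fin m → a) (Fin m → a) ℂ}
    {σ : Matrix (Fin n → a) (Fin n → a) ℂ} (hρ : IsState ρ) (hσ : IsState σ) :
    entropy (QChan.appendTensor ρ σ) = entropy ρ + entropy σ := by
  rw [QChan.appendTensor, entropy_submatrix_equiv (hρ.kronecker hσ).1.1, entropy_kronecker hρ hσ]

/-- Coherent information is additive on product states. -/
theorem IsCoherentInformation.add {Φ : Matrix a a ℂ →ₗ[ℂ] Matrix b b ℂ} {m n : ℕ}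
    {ρ : Matrix (Fin m → a) (Fin m → a) ℂ} {σ : Matrix (Fin n → a) (Fin n → a) ℂ} {x y : ℝ}
    (hρ : IsState ρ) (hσ : IsState σ) (hx : IsCoherentInformation (tensorPower Φ m) ρ x)
    (hy : IsCoherentInformation (tensorPower Φ n) σ y) :
    IsCoherentInformation (tensorPower Φ (m + n)) (appendTensor ρ σ) (x + y) := by
  obtain ⟨E₁, _, _, Φ₁, hc₁, rfl⟩ := hx
  obtain ⟨E₂, _, _, Φ₂, hc₂, rfl⟩ := hy
  obtain ⟨V, hV, hVΦ⟩ := id hc₁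
  obtain ⟨W, hW, hWΦ⟩ := id hc₂
  -- The environments `E₁` and `E₂` come from arbitrary complementary maps, so the joint environment
  -- is their product rather than a tensor power.
  let Ψ : Matrix (Fin (m + n) → a) (Fin (m + n) → a) ℂ →ₗ[ℂ] Matrix (E₁ × E₂) (E₁ × E₂) ℂ :=
    { toFun := fun X => traceFst (appendIsometry V W * X * (appendIsometry V W)ᴴ)
      map_add' := fun X Y => by
        ext; simp [traceFst, Matrix.mul_add, Matrix.add_mul, Finset.sum_add_distrib]
      map_smul' := fun c X => by ext; simp [traceFst, Finset.mul_sum] }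
  let Ψ' : Matrix (Fin (m + n) → a) (Fin (m + n) → a) ℂ →ₗ[ℂ]
      Matrix (Fin (m + n) → b) (Fin (m + n) → b) ℂ :=
    { toFun := fun X => traceSnd (appendIsometry V W * X * (appendIsometry V W)ᴴ)
      map_add' := fun X Y => by
        ext; simp [traceSnd, Matrix.mul_add, Matrix.add_mul, Finset.sum_add_distrib]
      map_smul' := fun c X => by ext; simp [traceSnd, Finset.mul_sum] }
  have hΨ' : tensorPower Φ (m + n) = Ψ' := by
    -- By linearity matrix units suffice, and each of them factors across the splitting.
    refine Matrix.ext_linearMap _ fun h k => LinearMap.ext_ring ?_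
    change tensorPower Φ (m + n) (single h k 1) =
      traceSnd (appendIsometry V W * single h k 1 * (appendIsometry V W)ᴴ)
    rw [← appendTensor_single, tensorPower_appendTensor, traceSnd_appendIsometry_conj,
      (hVΦ _).1, (hWΦ _).1]
  have hΨ : Ψ (appendTensor ρ σ) = Φ₁ ρ ⊗ₖ Φ₂ σ := by
    change traceFst (appendIsometry V W * appendTensor ρ σ * (appendIsometry V W)ᴴ) = _
    rw [traceFst_appendIsometry_conj, (hVΦ _).2, (hWΦ _).2]
  refine ⟨E₁ × E₂, inferInstance, inferInstance, Ψ, ⟨appendIsometry V W,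
    appendIsometry_conjTranspose_mul hV hW, fun X => ⟨by rw [hΨ']; rfl, rfl⟩⟩, ?_⟩
  rw [hΨ, tensorPower_appendTensor, entropy_appendTensor (hc₁.isState_fst hρ)
    (hc₂.isState_fst hσ), entropy_kronecker (hc₁.isState_snd hρ) (hc₂.isState_snd hσ)]
  ring

/-! ### From zero capacity to an entropy inequality. -/

theorem IsCoherentInformation.le_log_card {Φ : Matrix a a ℂ →ₗ[ℂ] Matrix b b ℂ}
    {ρ : Matrix a a ℂ} {x : ℝ} (hρ : IsState ρ) (hx : IsCoherentInformation Φ ρ x) :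
    x ≤ Real.log (Fintype.card b) := by
  obtain ⟨E, _, _, Φc, hc, rfl⟩ := hx
  linarith [(hc.isState_fst hρ).entropy_le_log_card, (hc.isState_snd hρ).entropy_nonneg]

theorem bddAbove_coherentInformation (Φ : Matrix a a ℂ →ₗ[ℂ] Matrix b b ℂ) :
    BddAbove {x : ℝ | ∃ ρ : Matrix a a ℂ, IsState ρ ∧ IsCoherentInformation Φ ρ x} :=
  ⟨Real.log (Fintype.card b), fun _ ⟨_, hρ, hx⟩ => hx.le_log_card hρ⟩

theorem exists_isState [Nonempty a] : ∃ ρ : Matrix a a ℂ, IsState ρ := by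
  obtain ⟨i⟩ := ‹Nonempty a›
  exact ⟨_, IsUnitVector.isState_ketbra (ψ := Pi.single i 1) (by simp [IsUnitVector])⟩

section Capacity

variable {d d' d'' : ℕ} {Φ : Matrix (Fin d) (Fin d) ℂ →ₗ[ℂ] Matrix (Fin d') (Fin d') ℂ}
  {Φc : Matrix (Fin d) (Fin d) ℂ →ₗ[ℂ] Matrix (Fin d'') (Fin d'') ℂ}

theorem IsComplementary.isCoherentInformation (h : IsComplementary Φ Φc) (n : ℕ)
    (ρ : Matrix (Fin n → Fin d) (Fin n → Fin d) ℂ) :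
    IsCoherentInformation (QChan.tensorPower Φ n) ρ
      (entropy (QChan.tensorPower Φ n ρ) - entropy (QChan.tensorPower Φc n ρ)) :=
  ⟨_, _, _, _, h.tensorPower n, rfl⟩

theorem IsComplementary.nonempty_coherentInformation (h : IsComplementary Φ Φc) [NeZero d]
    (n : ℕ) : {x : ℝ | ∃ ρ : Matrix (Fin n → Fin d) (Fin n → Fin d) ℂ,
      IsState ρ ∧ IsCoherentInformation (QChan.tensorPower Φ n) ρ x}.Nonempty := by
  obtain ⟨ρ, hρ⟩ := exists_isState (a := Fin n → Fin d)
  exact ⟨_, ρ, hρ, h.isCoherentInformation n ρ⟩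

/-- Product states make the coherent information superadditive; the sign puts it in the form of
Fekete's lemma. `NeZero d` provides states, so no supremum is over an empty set. -/
theorem IsComplementary.subadditive_neg_maxCoherentInformation (h : IsComplementary Φ Φc)
    [NeZero d] : Subadditive fun n => -maxCoherentInformation (QChan.tensorPower Φ n) := by
  intro m n
  have key : maxCoherentInformation (QChan.tensorPower Φ m) +
      maxCoherentInformation (QChan.tensorPower Φ n) ≤
      maxCoherentInformation (QChan.tensorPower Φ (m + n)) := by
    rw [← le_sub_iff_add_le]
    refine csSup_le (h.nonempty_coherentInformation m) fun x ⟨ρ, hρ, hx⟩ => ?_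
    rw [le_sub_comm]
    refine csSup_le (h.nonempty_coherentInformation n) fun y ⟨σ, hσ, hy⟩ => ?_
    rw [le_sub_iff_add_le, add_comm]
    exact le_csSup (bddAbove_coherentInformation _) ⟨_, hρ.appendTensor hσ, hx.add hρ hσ hy⟩
  simp only
  linarith

theorem IsComplementary.maxCoherentInformation_le (h : IsComplementary Φ Φc) [NeZero d] (n : ℕ) :
    maxCoherentInformation (QChan.tensorPower Φ n) ≤ n * Real.log d' := by
  refine csSup_le (h.nonempty_coherentInformation n) fun x ⟨ρ, hρ, hx⟩ => ?_
  simpa using hx.le_log_card hρ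

theorem IsComplementary.bddBelow_neg_maxCoherentInformation (h : IsComplementary Φ Φc)
    [NeZero d] : BddBelow (Set.range fun n : ℕ =>
      -maxCoherentInformation (QChan.tensorPower Φ n) / n) := by
  refine ⟨-Real.log d', ?_⟩
  rintro _ ⟨n, rfl⟩
  -- At `n = 0` the quotient is 0 by the convention for division by zero.
  rcases Nat.eq_zero_or_pos n with rfl | hn
  · simpa using Real.log_natCast_nonneg d'
  · have hn' : (0 : ℝ) < n := by exact_mod_cast hn
    simp only
    rw [le_div_iff₀ hn']
    linarith [h.maxCoherentInformation_le n]

/-- The quantum capacity bounds the normalized coherent information of every tensor power. -/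
theorem IsComplementary.maxCoherentInformation_div_le (h : IsComplementary Φ Φc) [NeZero d]
    {n : ℕ} (hn : n ≠ 0) :
    maxCoherentInformation (QChan.tensorPower Φ n) / n ≤ quantumCapacity Φ := by
  have hsub := h.subadditive_neg_maxCoherentInformation
  have hbdd := h.bddBelow_neg_maxCoherentInformation
  have hlim := (hsub.tendsto_lim hbdd).neg
  simp only [neg_div, neg_neg] at hlim
  rw [quantumCapacity, hlim.limUnder_eq]
  have := hsub.lim_le_div hbdd hn
  rw [neg_div] at this
  linarith

theorem IsComplementary.entropy_le_of_quantumCapacity (h : IsComplementary Φ Φc)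
    (hQ : quantumCapacity Φ = 0) {n : ℕ} {ρ : Matrix (Fin n → Fin d) (Fin n → Fin d) ℂ}
    (hρ : IsState ρ) :
    entropy (QChan.tensorPower Φ n ρ) ≤ entropy (QChan.tensorPower Φc n ρ) := by
  -- The capacity bound needs `n ≠ 0`. On zero copies the output space is one-dimensional, so the
  -- left entropy is at most log 1 = 0.
  rcases Nat.eq_zero_or_pos n with rfl | hn
  · have h1 := ((h.tensorPower 0).isState_fst hρ).entropy_le_log_card
    have h2 := ((h.tensorPower 0).isState_snd hρ).entropy_nonneg
    simp only [Fintype.card_pi, Finset.univ_eq_empty, Finset.prod_empty, Nat.cast_one,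
      Real.log_one] at h1
    linarith
  · have hd : NeZero d := by
      refine ⟨fun hd => ?_⟩
      subst hd
      have : IsEmpty (Fin n → Fin 0) := ⟨fun f => (f ⟨0, hn⟩).elim0⟩
      have := hρ.2
      simp [Matrix.trace] at this
    have h1 := h.maxCoherentInformation_div_le hn.ne'
    rw [hQ, div_le_iff₀ (by exact_mod_cast hn), zero_mul] at h1
    have h2 := le_csSup (bddAbove_coherentInformation (QChan.tensorPower Φ n))
      ⟨ρ, hρ, h.isCoherentInformation n ρ⟩
    rw [maxCoherentInformation] at h1
    linarith

end Capacity

/-! ### From trace inequalities on pure states to the operator order. -/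

theorem IsComplementary.map_conjTranspose {Φ : Matrix a a ℂ →ₗ[ℂ] Matrix b b ℂ}
    {Φc : Matrix a a ℂ →ₗ[ℂ] Matrix e e ℂ} (h : IsComplementary Φ Φc) (X : Matrix a a ℂ) :
    Φ Xᴴ = (Φ X)ᴴ ∧ Φc Xᴴ = (Φc X)ᴴ := by
  obtain ⟨V, -, h⟩ := h
  have : V * Xᴴ * Vᴴ = (V * X * Vᴴ)ᴴ := by simp [Matrix.mul_assoc]
  rw [(h _).1, (h _).2, (h _).1, (h _).2, this]
  constructor <;> ext i j <;> simp [traceSnd, traceFst]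

theorem adjoint_isHermitian {Φ : Matrix a a ℂ →ₗ[ℂ] Matrix b b ℂ}
    (h : ∀ X, Φ Xᴴ = (Φ X)ᴴ) {Y : Matrix b b ℂ} (hY : Y.IsHermitian) :
    (adjoint Φ Y).IsHermitian := by
  ext i j
  simp only [adjoint, LinearMap.coe_mk, AddHom.coe_mk, conjTranspose_apply, of_apply]
  rw [← trace_conjTranspose, conjTranspose_mul, hY.eq, ← h, conjTranspose_single, star_one,
    Matrix.trace_mul_comm]

theorem dotProduct_mulVec_eq_trace (M : Matrix a a ℂ) (x : a → ℂ) :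
    star x ⬝ᵥ (M *ᵥ x) = (ketbra x * M).trace := by
  rw [ketbra, vecMulVec_mul, trace_vecMulVec, dotProduct_comm x, dotProduct_mulVec]

theorem le_of_forall_unitVector {M N : Matrix a a ℂ} (hM : M.IsHermitian) (hN : N.IsHermitian)
    (h : ∀ φ : a → ℂ, IsUnitVector φ →
      (ketbra φ * M).trace.re ≤ (ketbra φ * N).trace.re) : M ≤ N := by
  rw [Matrix.le_iff]
  refine (posSemidef_iff_dotProduct_mulVec (R := ℂ)).mpr ⟨hN.sub hM, fun x => ?_⟩
  have him : (star x ⬝ᵥ ((N - M) *ᵥ x)).im = 0 := (hN.sub hM).im_star_dotProduct_mulVec_self x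
  rw [Complex.nonneg_iff]
  refine ⟨?_, him.symm⟩
  by_cases hx : x = 0
  · simp [hx]
  obtain ⟨r, hr, hxr⟩ : ∃ r : ℝ, 0 < r ∧ star x ⬝ᵥ x = ((r ^ 2 : ℝ) : ℂ) := by
    have hpos := Complex.pos_iff.mp (dotProduct_star_self_pos_iff.mpr hx)
    refine ⟨√(star x ⬝ᵥ x).re, Real.sqrt_pos.mpr ?_, ?_⟩
    · exact hpos.1
    · rw [Real.sq_sqrt hpos.1.le]
      exact Complex.ext rfl (by simpa using hpos.2.symm)
  have hunit : IsUnitVector ((r⁻¹ : ℂ) • x) := by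
    rw [IsUnitVector, star_smul, smul_dotProduct, dotProduct_smul, hxr]
    have : (r : ℂ) ≠ 0 := by exact_mod_cast hr.ne'
    simp
    field_simp
  have hx' : x = (r : ℂ) • ((r⁻¹ : ℂ) • x) := by
    rw [smul_smul, mul_inv_cancel₀ (by exact_mod_cast hr.ne'), one_smul]
  have hφ := h _ hunit
  rw [← sub_nonneg, ← Complex.sub_re, ← Matrix.trace_sub, ← Matrix.mul_sub,
    ← dotProduct_mulVec_eq_trace] at hφ
  rw [hx', star_smul, mulVec_smul, smul_dotProduct, dotProduct_smul, smul_smul, Complex.star_def,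
    Complex.conj_ofReal, ← Complex.ofReal_mul, smul_eq_mul, Complex.re_ofReal_mul]
  exact mul_nonneg (by positivity) hφ

end QChan

end

theorem theorem3p6 (d dout denv : ℕ)
    (Φ : Matrix (Fin d) (Fin d) ℂ →ₗ[ℂ] Matrix (Fin dout) (Fin dout) ℂ)
    (Φc : Matrix (Fin d) (Fin d) ℂ →ₗ[ℂ] Matrix (Fin denv) (Fin denv) ℂ)
    (hΦ : QChan.IsChannel Φ) (hΦc : QChan.IsChannel Φc)
    (hcompl : QChan.IsComplementary Φ Φc)
    (hQ : QChan.quantumCapacity Φ = 0)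
    (n : ℕ) (ψ : (Fin n → Fin d) → ℂ) (hψ : QChan.IsUnitVector ψ) :
    QChan.adjoint (QChan.tensorPower Φc n)
        (QChan.rangeProjection (QChan.tensorPower Φc n (QChan.ketbra ψ))) ≤
      QChan.adjoint (QChan.tensorPower Φ n)
        (QChan.rangeProjection (QChan.tensorPower Φ n (QChan.ketbra ψ))) := by

  have hn := hcompl.tensorPower n
  have hψs := hψ.isState_ketbra
  have hA := hn.isState_fst hψs
  have hA' := hn.isState_snd hψs
  refine QChan.le_of_forall_unitVector
    (QChan.adjoint_isHermitian (fun X => (hn.map_conjTranspose X).2)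
      (QChan.rangeProjection_isHermitian hA'.1.1))
    (QChan.adjoint_isHermitian (fun X => (hn.map_conjTranspose X).1)
      (QChan.rangeProjection_isHermitian hA.1.1)) fun φ hφ => ?_
  have hφs := hφ.isState_ketbra
  rw [← QChan.trace_adjoint, ← QChan.trace_adjoint]
  -- The perturbed states are the outputs of ψ, the perturbations those of φ; by linearity the
  -- mixture of outputs is the output of the mixed input (1-ε)ψ + εφ.
  refine QChan.trace_mul_rangeProjection_le hA (hn.isState_fst hφs) hA' (hn.isState_snd hφs)
    (hn.entropy_ketbra ψ).ge fun ε h0 h1 => ?_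
  have := hcompl.entropy_le_of_quantumCapacity hQ (hψs.mix hφs h0.le h1.le)
  rwa [map_add, map_add, map_smul, map_smul, map_smul, map_smul] at this
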